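/- Let $\mathsf G$ be a discrete group with unit $\mathsf e$. An \emph{admissible algebra} $\mathcal L(\mathsf G)$ is a linear subspace of $\ell^1(\mathsf G)$ with its own complete norm $\|\cdot\|_{\mathcal L}$, stronger than the $\ell^1$-norm, which is solid (if $|k|\le|l|$ pointwise and $l\in\mathcal L(\mathsf G)$, then $k\in\mathcal L(\mathsf G)$ and $\|k\|_{\mathcal L}\le\|l\|_{\mathcal L}$) and which is a unital Banach $^*$-algebra (submultiplicative norm, isometric involution) for the convolution $(k\star l)(x)=\sum_{y}k(y)\,l(y^{-1}x)$ and the involution $k^\star(x)=\overline{k(x^{-1})}$. For a C*-algebra $\mathcal A$ (unital or not), $\mathcal L(\mathsf G;\mathcal A)$ is the Banach $^*$-algebra of all $f:\mathsf G\to\mathcal A$ with $\|f(\cdot)\|_{\mathcal A}\in\mathcal L(\mathsf G)$, with product $(f\star g)(x)=\sum_y f(y)\,g(y^{-1}x)$, involution $f^\star(x)=f(x^{-1})^*$ and norm $\big\|\,\|f(\cdot)\|_{\mathcal A}\big\|_{\mathcal L}$. A Banach $^*$-algebra $\mathcal B$ is \emph{symmetric} if the spectrum of $B^*B$ is contained in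 $[0,\infty)$ for every $B\in\mathcal B$ (the spectrum being computed in the unitization if $\mathcal B$ has no unit). The group $\mathsf G$ is \emph{rigidly $\mathcal L$-symmetric} if $\mathcal L(\mathsf G;\mathcal A)$ is symmetric for every C*-algebra $\mathcal A$. Let $\mathcal A(\mathsf G)$ be a unital C*-subalgebra of $\ell^\infty(\mathsf G)$ that is invariant under the translations $[\alpha_x(\varphi)](y)=\varphi(x^{-1}y)$. An \emph{$\mathcal A(\mathsf G)$-valued $2$-cocycle} is a map $\omega$ from $\mathsf G\times\mathsf G$ to the unitary group of $\mathcal A(\mathsf G)$ with $$\omega(x,y)\,\omega(xy,z)=\alpha_x[\omega(y,z)]\,\omega(x,yz),\qquad \omega(x,\mathsf e)=1=\omega(\mathsf e,x)$$ for all $x,y,z\in\mathsf G$; write $\omega(x,y;z)$ for the value of the function $\omega(x,y)$ at $z$. Let $\mathfrak K^{\mathcal L,\mathcal A}_{\omega}(\mathsf G\times\mathsf G)$ be the space of all $K:\mathsf G\times\mathsf G\to\mathbb C$ such that for some $k\in\mathcal L(\mathsf G)$ one has $|K(x,y)|\le|k(xy^{-1})|$ for all $x,y$, and such that $z\mapsto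 K(xz,yz)$ belongs to $\mathcal A(\mathsf G)$ for all $x,y$. It is a Banach $^*$-algebra with $$(K\bullet_\omega M)(x,y)=\sum_{z\in\mathsf G}K(x,z)\,M(z,y)\,\omega(xz^{-1},zy^{-1};x),$$ $$K^{\bullet_\omega}(x,y)=\overline{\omega(xy^{-1},yx^{-1};x)}\;\overline{K(y,x)},$$ $$\|K\|=\inf\{\|k\|_{\mathcal L}\mid |K(x,y)|\le|k(xy^{-1})|\ \ \forall\,x,y\in\mathsf G\}.$$ \textbf{Claim.} If $\mathcal L(\mathsf G)$ is an admissible algebra, $\mathsf G$ is rigidly $\mathcal L$-symmetric, and $\mathcal A(\mathsf G)$ is a translation-invariant unital C*-subalgebra of $\ell^\infty(\mathsf G)$, then the Banach $^*$-algebra $\mathfrak K^{\mathcal L,\mathcal A}_{\omega}(\mathsf G\times\mathsf G)$ is symmetric for every $\mathcal A(\mathsf G)$-valued $2$-cocycle $\omega$. -/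

import Mathlib

open scoped ENNReal ComplexOrder

universe u

noncomputable section

namespace TwistedKernel

/-! ## Symmetric star-algebras -/

/-- A complex Banach `*`-algebra `B` (unital or not) is symmetric if the spectrum of `b* b` is
contained in `[0, ∞)` for every `b`. The spectrum is the quasispectrum, i.e. the spectrum in the
unitization (for unital `B` it is the usual spectrum together with `0`).
The inequality `0 ≤ z` in `ℂ` says that `z` is real and nonnegative. -/
def IsSymmetric (B : Type*) [NonUnitalNormedRing B] [CompleteSpace B] [NormedSpace ℂ B]
    [IsScalarTower ℂ B B] [SMulCommClass ℂ B B] [StarRing B] [StarModule ℂ B]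
    [NormedStarGroup B] : Prop :=
  ∀ b : B, ∀ z ∈ quasispectrum ℂ (star b * b), 0 ≤ z

/-! ## Convolution and admissible algebras -/

section Conv

variable {G : Type u} [Group G]

/-- Convolution on the discrete group `G`: `(f ⋆ g)(x) = ∑ y, f y * g (y⁻¹ x)`. -/
def conv {R : Type*} [NonUnitalNormedRing R] (f g : G → R) : G → R :=
  fun x => ∑' y, f y * g (y⁻¹ * x)

/-- The involution `f⋆(x) = f(x⁻¹)*`. -/
def invol {R : Type*} [Star R] (f : G → R) : G → R :=
  fun x => star (f x⁻¹)

end Conv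

/-- An admissible algebra on `G`: a linear subspace `carrier` of `ℓ¹(G)` with its own complete norm
`nrm`, stronger than the `ℓ¹`-norm, which is solid and is a unital Banach `*`-algebra for
convolution and the involution `k⋆(x) = conj k(x⁻¹)`.
Only the values of `nrm` on `carrier` are meaningful. -/
structure AdmissibleAlgebra (G : Type u) [Group G] where
  carrier : Submodule ℂ (G → ℂ)
  nrm : (G → ℂ) → ℝ
  summable : ∀ k ∈ carrier, Summable fun x => ‖k x‖
  nrm_add_le : ∀ k ∈ carrier, ∀ l ∈ carrier, nrm (k + l) ≤ nrm k + nrm l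
  nrm_smul : ∀ (c : ℂ), ∀ k ∈ carrier, nrm (c • k) = ‖c‖ * nrm k
  stronger : ∃ C : ℝ, ∀ k ∈ carrier, ∑' x, ‖k x‖ ≤ C * nrm k
  complete : ∀ u : ℕ → G → ℂ, (∀ n, u n ∈ carrier) →
    (∀ ε > 0, ∃ N, ∀ m ≥ N, ∀ n ≥ N, nrm (u m - u n) < ε) →
    ∃ k ∈ carrier, Filter.Tendsto (fun n => nrm (u n - k)) Filter.atTop (nhds 0)
  solid : ∀ k : G → ℂ, ∀ l ∈ carrier, (∀ x, ‖k x‖ ≤ ‖l x‖) → k ∈ carrier ∧ nrm k ≤ nrm l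
  conv_mem : ∀ k ∈ carrier, ∀ l ∈ carrier, conv k l ∈ carrier
  nrm_conv_le : ∀ k ∈ carrier, ∀ l ∈ carrier, nrm (conv k l) ≤ nrm k * nrm l
  invol_mem : ∀ k ∈ carrier, invol k ∈ carrier
  nrm_invol : ∀ k ∈ carrier, nrm (invol k) = nrm k
  one_mem : Set.indicator {(1 : G)} (fun _ => (1 : ℂ)) ∈ carrier

/-! ### Auxiliary facts on dominated kernels -/

section Aux

variable {G : Type u} [Group G]

/-- The composition of two kernels, with scalar weights `w`. -/
def wmul {R : Type*} [NonUnitalNormedRing R] [Module ℂ R] (w : G → G → G → ℂ) (K L : G → G → R) :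
    G → G → R :=
  fun x y => ∑' z, w x z y • (K x z * L z y)

theorem summable_dom {k l : G → ℝ} (hk0 : ∀ x, 0 ≤ k x) (hl0 : ∀ x, 0 ≤ l x)
    (hk : Summable k) (hl : Summable l) (x y : G) :
    Summable fun z => k (x * z⁻¹) * l (z * y⁻¹) := by
  have h1 : Summable fun z => k (x * z⁻¹) :=
    hk.comp_injective (i := fun z => x * z⁻¹) (fun a b h => by simpa using h)
  refine Summable.of_nonneg_of_le (fun z => mul_nonneg (hk0 _) (hl0 _)) (fun z => ?_)
    (h1.mul_right (∑' a, l a))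
  exact mul_le_mul_of_nonneg_left (hl.le_tsum _ (fun j _ => hl0 j)) (hk0 _)

variable {R : Type*} [NonUnitalNormedRing R] [NormedSpace ℂ R]

theorem norm_wmul_term {w : G → G → G → ℂ} (hw : ∀ x z y, ‖w x z y‖ = 1) {K L : G → G → R}
    {k l : G → ℝ} (hK : ∀ x y, ‖K x y‖ ≤ k (x * y⁻¹)) (hL : ∀ x y, ‖L x y‖ ≤ l (x * y⁻¹))
    (x y z : G) : ‖w x z y • (K x z * L z y)‖ ≤ k (x * z⁻¹) * l (z * y⁻¹) := by
  rw [norm_smul, hw, one_mul]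
  exact (norm_mul_le _ _).trans
    (mul_le_mul (hK _ _) (hL _ _) (norm_nonneg _) ((norm_nonneg _).trans (hK x z)))

theorem summable_wmul [CompleteSpace R] {w : G → G → G → ℂ} (hw : ∀ x z y, ‖w x z y‖ = 1)
    {K L : G → G → R} {k l : G → ℝ} (hk0 : ∀ x, 0 ≤ k x) (hl0 : ∀ x, 0 ≤ l x)
    (hk : Summable k) (hl : Summable l)
    (hK : ∀ x y, ‖K x y‖ ≤ k (x * y⁻¹)) (hL : ∀ x y, ‖L x y‖ ≤ l (x * y⁻¹)) (x y : G) :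
    Summable fun z => w x z y • (K x z * L z y) :=
  Summable.of_norm_bounded (summable_dom hk0 hl0 hk hl x y) (norm_wmul_term hw hK hL x y)

theorem summable_triple {k l m : G → ℝ} (hk0 : ∀ x, 0 ≤ k x) (hl0 : ∀ x, 0 ≤ l x)
    (hm0 : ∀ x, 0 ≤ m x) (hk : Summable k) (hl : Summable l) (hm : Summable m) (x y : G) :
    Summable fun p : G × G => k (x * p.1⁻¹) * l (p.1 * p.2⁻¹) * m (p.2 * y⁻¹) := by
  have h1 : Summable fun p : G × G => k p.1 * l p.2 := hk.mul_of_nonneg hl hk0 hl0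
  have h2 : Summable fun p : G × G => k (x * p.1⁻¹) * l (p.1 * p.2⁻¹) :=
    h1.comp_injective (i := fun p : G × G => (x * p.1⁻¹, p.1 * p.2⁻¹)) (by
      rintro ⟨a, b⟩ ⟨c, d⟩ h
      simp only [Prod.mk.injEq, mul_right_inj, inv_inj] at h
      obtain ⟨rfl, h⟩ := h
      simpa using h)
  refine Summable.of_nonneg_of_le
    (fun z => mul_nonneg (mul_nonneg (hk0 _) (hl0 _)) (hm0 _)) (fun z => ?_)
    (h2.mul_right (∑' a, m a))
  exact mul_le_mul_of_nonneg_left (hm.le_tsum _ (fun j _ => hm0 j))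
    (mul_nonneg (hk0 _) (hl0 _))

theorem wmul_assoc [CompleteSpace R] [IsScalarTower ℂ R R] [SMulCommClass ℂ R R]
    {w : G → G → G → ℂ} (hw : ∀ x z y, ‖w x z y‖ = 1)
    (hc : ∀ x b a y, w x b a * w x a y = w b a y * w x b y)
    {K L M : G → G → R} {k l m : G → ℝ} (hk0 : ∀ x, 0 ≤ k x) (hl0 : ∀ x, 0 ≤ l x)
    (hm0 : ∀ x, 0 ≤ m x) (hk : Summable k) (hl : Summable l) (hm : Summable m)
    (hK : ∀ x y, ‖K x y‖ ≤ k (x * y⁻¹)) (hL : ∀ x y, ‖L x y‖ ≤ l (x * y⁻¹))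
    (hM : ∀ x y, ‖M x y‖ ≤ m (x * y⁻¹)) :
    wmul w (wmul w K L) M = wmul w K (wmul w L M) := by
  funext x y
  have hL1 : ∀ a, w x a y • (wmul w K L x a * M a y)
      = ∑' b, (w x b a * w x a y) • (K x b * L b a * M a y) := by
    intro a
    unfold wmul
    rw [← (summable_wmul hw hk0 hl0 hk hl hK hL x a).tsum_mul_right, ← tsum_const_smul'']
    refine tsum_congr fun b => ?_
    rw [smul_mul_assoc, smul_smul, mul_comm]
  have hR1 : ∀ b, w x b y • (K x b * wmul w L M b y)
      = ∑' a, (w x b a * w x a y) • (K x b * L b a * M a y) := by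
    intro b
    unfold wmul
    rw [← (summable_wmul hw hl0 hm0 hl hm hL hM b y).tsum_mul_left, ← tsum_const_smul'']
    refine tsum_congr fun a => ?_
    rw [mul_smul_comm, smul_smul, mul_comm, hc, mul_assoc]
  change ∑' a, w x a y • (wmul w K L x a * M a y) = ∑' b, w x b y • (K x b * wmul w L M b y)
  rw [tsum_congr hL1, tsum_congr hR1]
  refine Summable.tsum_comm (f := fun b a => (w x b a * w x a y) • (K x b * L b a * M a y)) ?_
  refine Summable.of_norm_bounded (summable_triple hk0 hl0 hm0 hk hl hm x y) ?_
  rintro ⟨b, a⟩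
  simp only [Function.uncurry]
  rw [norm_smul, norm_mul, hw, hw, one_mul, one_mul]
  refine (norm_mul_le _ _).trans (mul_le_mul ((norm_mul_le _ _).trans
    (mul_le_mul (hK _ _) (hL _ _) (norm_nonneg _) ?_)) (hM _ _) (norm_nonneg _) ?_)
  · exact hk0 _
  · exact mul_nonneg (hk0 _) (hl0 _)

theorem conv_eq_wmul (f g : G → R) (x y : G) :
    conv f g (x * y⁻¹)
      = wmul (fun _ _ _ => 1) (fun a b => f (a * b⁻¹)) (fun a b => g (a * b⁻¹)) x y := by
  unfold conv wmul
  rw [← ((Equiv.inv G).trans (Equiv.mulLeft x)).tsum_eq]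
  refine tsum_congr fun z => ?_
  simp [mul_assoc]

theorem summable_conv {R : Type*} [NonUnitalNormedRing R] [CompleteSpace R] {f g : G → R} (hf : Summable fun x => ‖f x‖)
    (hg : Summable fun x => ‖g x‖) (x : G) : Summable fun y => f y * g (y⁻¹ * x) := by
  refine Summable.of_norm_bounded (g := fun y => ‖f y‖ * ∑' a, ‖g a‖)
    (hf.mul_right _) (fun y => (norm_mul_le _ _).trans ?_)
  exact mul_le_mul_of_nonneg_left (hg.le_tsum _ (fun j _ => norm_nonneg _)) (norm_nonneg _)

theorem conv_assoc [CompleteSpace R] [IsScalarTower ℂ R R] [SMulCommClass ℂ R R]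
    {f g h : G → R} (hf : Summable fun x => ‖f x‖)
    (hg : Summable fun x => ‖g x‖) (hh : Summable fun x => ‖h x‖) :
    conv (conv f g) h = conv f (conv g h) := by
  have key := wmul_assoc (w := fun _ _ _ : G => (1 : ℂ)) (by simp) (by simp)
    (K := fun a b => f (a * b⁻¹)) (L := fun a b => g (a * b⁻¹)) (M := fun a b => h (a * b⁻¹))
    (fun x => norm_nonneg (f x)) (fun x => norm_nonneg (g x)) (fun x => norm_nonneg (h x))
    hf hg hh (fun _ _ => le_rfl) (fun _ _ => le_rfl) (fun _ _ => le_rfl)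
  funext x
  have e1 := conv_eq_wmul (conv f g) h x 1
  have e2 := conv_eq_wmul f (conv g h) x 1
  simp only [inv_one, mul_one] at e1 e2
  rw [e1, e2]
  have h1 : (fun a b => conv f g (a * b⁻¹)) = wmul (fun _ _ _ => 1) (fun a b => f (a * b⁻¹))
      (fun a b => g (a * b⁻¹)) := by
    funext a b; exact conv_eq_wmul f g a b
  have h2 : (fun a b => conv g h (a * b⁻¹)) = wmul (fun _ _ _ => 1) (fun a b => g (a * b⁻¹))
      (fun a b => h (a * b⁻¹)) := by
    funext a b; exact conv_eq_wmul g h a b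
  rw [h1, h2, key]

end Aux

/-! ### Auxiliary facts on admissible algebras -/

namespace AdmissibleAlgebra

section Abs

variable {G : Type u}

/-- The pointwise absolute value of a vector-valued function, as a complex function. -/
def abs {R : Type*} [Norm R] (f : G → R) : G → ℂ := fun x => ((‖f x‖ : ℝ) : ℂ)

@[simp] theorem norm_abs {R : Type*} [NormedAddCommGroup R] (f : G → R) (x : G) :
    ‖abs f x‖ = ‖f x‖ := by simp [abs]

end Abs

variable {G : Type u} [Group G] (L : AdmissibleAlgebra G)

theorem abs_mem {k : G → ℂ} (hk : k ∈ L.carrier) : abs k ∈ L.carrier :=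
  (L.solid _ k hk (by simp)).1

theorem nrm_abs {k : G → ℂ} (hk : k ∈ L.carrier) : L.nrm (abs k) = L.nrm k :=
  le_antisymm (L.solid _ k hk (by simp)).2 (L.solid _ _ (L.abs_mem hk) (by simp)).2

theorem nrm_zero : L.nrm 0 = 0 := by
  have := L.nrm_smul 0 0 L.carrier.zero_mem
  simpa using this

theorem nrm_neg {k : G → ℂ} (hk : k ∈ L.carrier) : L.nrm (-k) = L.nrm k := by
  have := L.nrm_smul (-1) k hk
  simpa using this

theorem nrm_nonneg {k : G → ℂ} (hk : k ∈ L.carrier) : 0 ≤ L.nrm k := by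
  have h := L.nrm_add_le k hk (-k) (L.carrier.neg_mem hk)
  rw [add_neg_cancel, L.nrm_zero, L.nrm_neg hk] at h
  linarith

theorem exists_bound : ∃ C : ℝ, 0 ≤ C ∧ ∀ k ∈ L.carrier, ∀ x, ‖k x‖ ≤ C * L.nrm k := by
  obtain ⟨C, hC⟩ := L.stronger
  refine ⟨max C 0, le_max_right _ _, fun k hk x => ?_⟩
  calc ‖k x‖ ≤ ∑' x, ‖k x‖ := (L.summable k hk).le_tsum x (fun j _ => norm_nonneg _)
    _ ≤ C * L.nrm k := hC k hk
    _ ≤ max C 0 * L.nrm k := mul_le_mul_of_nonneg_right (le_max_left _ _) (L.nrm_nonneg hk)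

theorem conv_abs_apply {k l : G → ℂ} (x : G) :
    conv (abs k) (abs l) x = ((∑' y, ‖k y‖ * ‖l (y⁻¹ * x)‖ : ℝ) : ℂ) := by
  simp [conv, abs, Complex.ofReal_tsum]

theorem norm_conv_abs {k l : G → ℂ} (x : G) :
    ‖conv (abs k) (abs l) x‖ = ∑' y, ‖k y‖ * ‖l (y⁻¹ * x)‖ := by
  rw [conv_abs_apply, Complex.norm_real, Real.norm_eq_abs, abs_of_nonneg]
  exact tsum_nonneg fun y => by positivity

theorem conv_abs_mem {k l : G → ℂ} (hk : k ∈ L.carrier) (hl : l ∈ L.carrier) :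
    conv (abs k) (abs l) ∈ L.carrier :=
  L.conv_mem _ (L.abs_mem hk) _ (L.abs_mem hl)

theorem nrm_conv_abs_le {k l : G → ℂ} (hk : k ∈ L.carrier) (hl : l ∈ L.carrier) :
    L.nrm (conv (abs k) (abs l)) ≤ L.nrm k * L.nrm l := by
  refine (L.nrm_conv_le _ (L.abs_mem hk) _ (L.abs_mem hl)).trans ?_
  rw [L.nrm_abs hk, L.nrm_abs hl]

theorem nrm_sum_le {u : ℕ → G → ℂ} (hu : ∀ n, u n ∈ L.carrier) (s : Finset ℕ) :
    L.nrm (∑ i ∈ s, u i) ≤ ∑ i ∈ s, L.nrm (u i) := by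
  classical
  induction s using Finset.induction_on with
  | empty => simp [L.nrm_zero]
  | insert a s ha ih =>
    rw [Finset.sum_insert ha, Finset.sum_insert ha]
    exact (L.nrm_add_le _ (hu a) _ (L.carrier.sum_mem fun i _ => hu i)).trans (by linarith)

/-- An absolutely convergent series of nonnegative elements of an admissible algebra converges. -/
theorem exists_sum {u : ℕ → G → ℂ} (hu : ∀ n, u n ∈ L.carrier)
    (hs : Summable fun n => L.nrm (u n)) :
    ∃ k ∈ L.carrier, (∀ x, Summable fun n => ‖u n x‖) ∧
      (∀ x, HasSum (fun n => u n x) (k x)) ∧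
      Filter.Tendsto (fun n => L.nrm (k - ∑ i ∈ Finset.range n, u i)) Filter.atTop (nhds 0) := by
  obtain ⟨C, hC0, hC⟩ := L.exists_bound
  have hmem : ∀ n, ∑ i ∈ Finset.range n, u i ∈ L.carrier :=
    fun n => L.carrier.sum_mem fun i _ => hu i
  have hCau := hs.hasSum.tendsto_sum_nat.cauchySeq
  rw [Metric.cauchySeq_iff] at hCau
  have hdiff : ∀ m n, n ≤ m → L.nrm (∑ i ∈ Finset.range m, u i - ∑ i ∈ Finset.range n, u i)
      ≤ dist (∑ i ∈ Finset.range m, L.nrm (u i)) (∑ i ∈ Finset.range n, L.nrm (u i)) := by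
    intro m n h
    rw [← Finset.sum_Ico_eq_sub _ h, Real.dist_eq, ← Finset.sum_Ico_eq_sub _ h]
    exact (L.nrm_sum_le hu _).trans (le_abs_self _)
  obtain ⟨k, hk, hlim⟩ := L.complete _ hmem (fun ε hε => by
    obtain ⟨N, hN⟩ := hCau ε hε
    refine ⟨N, fun m hm n hn => ?_⟩
    rcases le_total n m with h | h
    · exact (hdiff m n h).trans_lt (hN m hm n hn)
    · rw [← L.nrm_neg (L.carrier.sub_mem (hmem m) (hmem n)), neg_sub]
      exact (hdiff n m h).trans_lt (hN n hn m hm))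
  have hsx : ∀ x, Summable fun n => ‖u n x‖ := fun x =>
    Summable.of_nonneg_of_le (fun n => norm_nonneg _) (fun n => hC _ (hu n) x) (hs.mul_left C)
  refine ⟨k, hk, hsx, fun x => ?_, ?_⟩
  · have h1 := (hsx x).of_norm.hasSum
    have h2 : Filter.Tendsto (fun n => ∑ i ∈ Finset.range n, u i x) Filter.atTop
        (nhds (k x)) := by
      rw [tendsto_iff_norm_sub_tendsto_zero]
      refine squeeze_zero (fun n => norm_nonneg _) (fun n => ?_)
        (by simpa using hlim.const_mul C)
      have := hC _ (L.carrier.sub_mem (hmem n) hk) x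
      simpa using this
    rwa [tendsto_nhds_unique h1.tendsto_sum_nat h2] at h1
  · refine hlim.congr fun n => ?_
    rw [← L.nrm_neg (L.carrier.sub_mem (hmem n) hk), neg_sub]

end AdmissibleAlgebra

/-! ## The algebras `𝓛(G; A)` and rigid symmetry -/

section Vector

variable {G : Type u} [Group G]

/-- The space `𝓛(G; A)` of functions `f : G → A` with `‖f(·)‖ ∈ 𝓛(G)`. -/
def vectorSubmodule (L : AdmissibleAlgebra G) (A : Type*) [NonUnitalCStarAlgebra A] :
    Submodule ℂ (G → A) where
  carrier := {f | (fun x => ((‖f x‖ : ℝ) : ℂ)) ∈ L.carrier}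
  zero_mem' := by
    have : (fun _ : G => ((‖(0 : A)‖ : ℝ) : ℂ)) = 0 := by funext; simp
    simp only [Set.mem_ofPred_eq, Pi.zero_apply, this, L.carrier.zero_mem]
  add_mem' := by
    intro f g hf hg
    refine (L.solid _ _ (L.carrier.add_mem hf hg) fun x => ?_).1
    simp only [Pi.add_apply, ← Complex.ofReal_add, Complex.norm_real, norm_norm]
    exact (norm_add_le _ _).trans (le_abs_self _)
  smul_mem' := by
    intro c f hf
    refine (L.solid _ _ (L.carrier.smul_mem c hf) fun x => ?_).1
    simp [norm_smul]

/-- The algebra `𝓛(G; A)`: the space of `A`-valued functions `f` with `‖f(·)‖ ∈ 𝓛(G)`, with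
convolution `(f ⋆ g)(x) = ∑ y, f(y) g(y⁻¹x)`, involution `f⋆(x) = f(x⁻¹)*` and norm
`‖ ‖f(·)‖ ‖_𝓛`. -/
def VectorAlgebra (L : AdmissibleAlgebra G) (A : Type*) [NonUnitalCStarAlgebra A] : Type _ :=
  ↥(vectorSubmodule L A)

namespace VectorAlgebra

variable {L : AdmissibleAlgebra G} {A : Type*} [NonUnitalCStarAlgebra A]

instance : AddCommGroup (VectorAlgebra L A) := inferInstanceAs (AddCommGroup (vectorSubmodule L A))

instance : Module ℂ (VectorAlgebra L A) := inferInstanceAs (Module ℂ (vectorSubmodule L A))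

/-- An element of `𝓛(G; A)` from its underlying function. -/
def mk (f : G → A) (hf : f ∈ vectorSubmodule L A) : VectorAlgebra L A := ⟨f, hf⟩

/-- The function underlying an element of `𝓛(G; A)`. -/
def toFun (f : VectorAlgebra L A) : G → A := f.1

@[ext] theorem ext {f g : VectorAlgebra L A} (h : f.toFun = g.toFun) : f = g := Subtype.ext h

@[simp] theorem toFun_mk (f : G → A) (hf : f ∈ vectorSubmodule L A) : (mk f hf).toFun = f := rfl
@[simp] theorem toFun_add (f g : VectorAlgebra L A) : (f + g).toFun = f.toFun + g.toFun := rfl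
@[simp] theorem toFun_zero : (0 : VectorAlgebra L A).toFun = 0 := rfl
@[simp] theorem toFun_neg (f : VectorAlgebra L A) : (-f).toFun = -f.toFun := rfl
@[simp] theorem toFun_sub (f g : VectorAlgebra L A) : (f - g).toFun = f.toFun - g.toFun := rfl
@[simp] theorem toFun_smul (c : ℂ) (f : VectorAlgebra L A) : (c • f).toFun = c • f.toFun := rfl

theorem abs_mem (f : VectorAlgebra L A) : AdmissibleAlgebra.abs f.toFun ∈ L.carrier := f.2

theorem summable_norm (f : VectorAlgebra L A) : Summable fun x => ‖f.toFun x‖ := by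
  simpa [AdmissibleAlgebra.abs] using L.summable _ f.abs_mem

theorem norm_conv_le (f g : VectorAlgebra L A) (x : G) : ‖conv f.toFun g.toFun x‖ ≤
    ‖conv (AdmissibleAlgebra.abs f.toFun) (AdmissibleAlgebra.abs g.toFun) x‖ := by
  have hs : Summable fun y => ‖f.toFun y‖ * ‖g.toFun (y⁻¹ * x)‖ := by
    refine Summable.of_nonneg_of_le (fun y => by positivity) (fun y => ?_)
      (f.summable_norm.mul_right (∑' a, ‖g.toFun a‖))
    exact mul_le_mul_of_nonneg_left (g.summable_norm.le_tsum _ (fun j _ => norm_nonneg _))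
      (norm_nonneg _)
  have : conv (AdmissibleAlgebra.abs f.toFun) (AdmissibleAlgebra.abs g.toFun) x
      = ((∑' y, ‖f.toFun y‖ * ‖g.toFun (y⁻¹ * x)‖ : ℝ) : ℂ) := by
    simp [conv, AdmissibleAlgebra.abs, Complex.ofReal_tsum]
  rw [this, Complex.norm_real, Real.norm_eq_abs]
  refine le_trans ?_ (le_abs_self _)
  exact tsum_of_norm_bounded hs.hasSum fun y => norm_mul_le _ _

theorem conv_mem (f g : VectorAlgebra L A) : conv f.toFun g.toFun ∈ vectorSubmodule L A := by
  refine (L.solid _ _ (L.conv_mem _ f.abs_mem _ g.abs_mem) fun x => ?_).1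
  rw [Complex.norm_real, norm_norm]
  exact norm_conv_le f g x

theorem invol_mem (f : VectorAlgebra L A) : invol f.toFun ∈ vectorSubmodule L A := by
  refine (L.solid _ _ (L.invol_mem _ f.abs_mem) fun x => ?_).1
  simp [invol, AdmissibleAlgebra.abs]

instance : Mul (VectorAlgebra L A) := ⟨fun f g => mk (conv f.toFun g.toFun) (conv_mem f g)⟩

instance : Star (VectorAlgebra L A) := ⟨fun f => mk (invol f.toFun) (invol_mem f)⟩

@[simp] theorem toFun_mul (f g : VectorAlgebra L A) :
    (f * g).toFun = conv f.toFun g.toFun := rfl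

@[simp] theorem toFun_star (f : VectorAlgebra L A) : (star f).toFun = invol f.toFun := rfl

theorem summable_mul (f g : VectorAlgebra L A) (x : G) :
    Summable fun y => f.toFun y * g.toFun (y⁻¹ * x) :=
  summable_conv f.summable_norm g.summable_norm x

instance : NonUnitalRing (VectorAlgebra L A) :=
  { (inferInstance : AddCommGroup (VectorAlgebra L A)),
    (inferInstance : Mul (VectorAlgebra L A)) with
    left_distrib := fun f g h => by
      ext x
      simp only [toFun_mul, toFun_add, conv, Pi.add_apply, mul_add]
      exact (summable_mul f g x).tsum_add (summable_mul f h x)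
    right_distrib := fun f g h => by
      ext x
      simp only [toFun_mul, toFun_add, conv, Pi.add_apply, add_mul]
      exact (summable_mul f h x).tsum_add (summable_mul g h x)
    zero_mul := fun f => by ext x; simp [conv]
    mul_zero := fun f => by ext x; simp [conv]
    mul_assoc := fun f g h => by
      ext1
      exact conv_assoc f.summable_norm g.summable_norm h.summable_norm }

instance : StarRing (VectorAlgebra L A) where
  star_involutive := fun f => by ext x; simp [invol]
  star_mul := fun f g => by
    ext x
    simp only [toFun_star, toFun_mul, invol, conv]
    rw [tsum_star, ← (Equiv.mulLeft x⁻¹).tsum_eq]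
    refine tsum_congr fun y => ?_
    simp [star_mul]
  star_add := fun f g => by ext x; simp [invol]

instance : StarModule ℂ (VectorAlgebra L A) where
  star_smul := fun c f => by ext x; simp [invol]

instance : IsScalarTower ℂ (VectorAlgebra L A) (VectorAlgebra L A) where
  smul_assoc := fun c f g => by
    ext x
    simp only [smul_eq_mul, toFun_mul, toFun_smul, conv, Pi.smul_apply, smul_mul_assoc]
    exact tsum_const_smul'' c

instance : SMulCommClass ℂ (VectorAlgebra L A) (VectorAlgebra L A) where
  smul_comm := fun c f g => by
    ext x
    simp only [smul_eq_mul, toFun_mul, toFun_smul, conv, Pi.smul_apply, mul_smul_comm]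
    exact (tsum_const_smul'' c).symm

instance : Norm (VectorAlgebra L A) := ⟨fun f => L.nrm fun x => ((‖f.toFun x‖ : ℝ) : ℂ)⟩

theorem norm_def (f : VectorAlgebra L A) : ‖f‖ = L.nrm (AdmissibleAlgebra.abs f.toFun) := rfl

theorem norm_le (f : VectorAlgebra L A) {k : G → ℂ} (hk : k ∈ L.carrier)
    (h : ∀ x, ‖f.toFun x‖ ≤ ‖k x‖) : ‖f‖ ≤ L.nrm k :=
  (L.solid _ k hk (by simpa [AdmissibleAlgebra.abs] using h)).2

theorem normCore : NormedSpace.Core ℂ (VectorAlgebra L A) where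
  norm_nonneg := fun f => L.nrm_nonneg f.abs_mem
  norm_smul := fun c f => by
    have : AdmissibleAlgebra.abs (c • f).toFun = (‖c‖ : ℂ) • AdmissibleAlgebra.abs f.toFun := by
      funext x; simp [AdmissibleAlgebra.abs, norm_smul]
    rw [norm_def, norm_def, this, L.nrm_smul _ _ f.abs_mem]
    simp
  norm_triangle := fun f g => by
    refine le_trans (norm_le _ (L.carrier.add_mem f.abs_mem g.abs_mem) fun x => ?_)
      (L.nrm_add_le _ f.abs_mem _ g.abs_mem)
    simp only [AdmissibleAlgebra.abs, Pi.add_apply, toFun_add, ← Complex.ofReal_add,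
      Complex.norm_real]
    exact (norm_add_le _ _).trans (le_abs_self _)
  norm_eq_zero_iff := fun f => by
    constructor
    · intro h
      obtain ⟨C, -, hC⟩ := L.exists_bound
      ext x
      have := hC _ f.abs_mem x
      rw [← norm_def, h, mul_zero, AdmissibleAlgebra.norm_abs] at this
      simpa using this
    · rintro rfl
      have : AdmissibleAlgebra.abs (0 : VectorAlgebra L A).toFun = 0 := by
        funext x; simp [AdmissibleAlgebra.abs]
      rw [norm_def, this, L.nrm_zero]

instance : NormedAddCommGroup (VectorAlgebra L A) := NormedAddCommGroup.ofCore normCore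

instance : NonUnitalNormedRing (VectorAlgebra L A) :=
  { (inferInstance : NormedAddCommGroup (VectorAlgebra L A)),
    (inferInstance : NonUnitalRing (VectorAlgebra L A)) with
    norm_mul_le := fun f g => by
      refine (norm_le _ (L.conv_mem _ f.abs_mem _ g.abs_mem) (norm_conv_le f g)).trans ?_
      exact L.nrm_conv_le _ f.abs_mem _ g.abs_mem }

instance : NormedSpace ℂ (VectorAlgebra L A) where
  norm_smul_le := fun c f => (normCore.norm_smul c f).le

instance : NormedStarGroup (VectorAlgebra L A) where
  norm_star_le := fun f => by
    refine (norm_le (star f) (L.invol_mem _ f.abs_mem) fun x => ?_).trans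
      (L.nrm_invol _ f.abs_mem).le
    simp [invol, AdmissibleAlgebra.abs]

theorem toFun_sum (u : ℕ → VectorAlgebra L A) (s : Finset ℕ) (x : G) :
    (∑ i ∈ s, u i).toFun x = ∑ i ∈ s, (u i).toFun x := by
  classical
  induction s using Finset.induction_on with
  | empty => simp
  | insert a s ha ih => simp [Finset.sum_insert ha, ih]

instance : CompleteSpace (VectorAlgebra L A) := by
  refine NormedAddCommGroup.completeSpace_of_summable_imp_tendsto fun u hu => ?_
  obtain ⟨k, hk, hsx, hkx, hlim⟩ := L.exists_sum (fun n => (u n).abs_mem) hu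
  simp only [AdmissibleAlgebra.norm_abs] at hsx
  have hkx' : ∀ x, k x = ((∑' n, ‖(u n).toFun x‖ : ℝ) : ℂ) := fun x => by
    rw [← (hkx x).tsum_eq, Complex.ofReal_tsum]; rfl
  have hmem : (fun x => ∑' n, (u n).toFun x) ∈ vectorSubmodule L A := by
    refine (L.solid _ k hk fun x => ?_).1
    rw [hkx', Complex.norm_real, Complex.norm_real, norm_norm, Real.norm_eq_abs]
    exact (tsum_of_norm_bounded (hsx x).hasSum fun n => le_rfl).trans (le_abs_self _)
  refine ⟨mk _ hmem, ?_⟩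
  rw [tendsto_iff_norm_sub_tendsto_zero]
  refine squeeze_zero (fun n => norm_nonneg _) (fun n => ?_) hlim
  rw [norm_sub_rev]
  refine norm_le _ (L.carrier.sub_mem hk (L.carrier.sum_mem fun i _ => (u i).abs_mem)) fun x => ?_
  have e1 : (k - ∑ i ∈ Finset.range n, AdmissibleAlgebra.abs (u i).toFun) x
      = ((∑' i, ‖(u (i + n)).toFun x‖ : ℝ) : ℂ) := by
    rw [Pi.sub_apply, hkx', ← (hsx x).sum_add_tsum_nat_add n]
    simp [AdmissibleAlgebra.abs, Finset.sum_apply]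
  rw [e1, Complex.norm_real, Real.norm_eq_abs, toFun_sub, Pi.sub_apply, toFun_sum]
  change ‖∑' i, (u i).toFun x - _‖ ≤ _
  rw [← (hsx x).of_norm.sum_add_tsum_nat_add n, add_sub_cancel_left]
  exact (tsum_of_norm_bounded ((summable_nat_add_iff n).2 (hsx x)).hasSum
    fun n => le_rfl).trans (le_abs_self _)

end VectorAlgebra

end Vector

/-- `G` is rigidly `𝓛`-symmetric: `𝓛(G; A)` is symmetric for every C*-algebra `A`,
unital or not. -/
def IsRigidlySymmetric {G : Type u} [Group G] (L : AdmissibleAlgebra G) : Prop :=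
  ∀ (A : Type u) [NonUnitalCStarAlgebra A], IsSymmetric (VectorAlgebra L A)

/-! ## Translation-invariant C*-subalgebras of `ℓ^∞(G)` and 2-cocycles -/

section Kernel

variable {G : Type u} [Group G]

/-- The action of `G` on `ℓ^∞(G)` by left translations: `(α_x φ)(y) = φ(x⁻¹y)`. -/
def translate (x : G) (φ : lp (fun _ : G => ℂ) ∞) : lp (fun _ : G => ℂ) ∞ :=
  ⟨fun y => φ (x⁻¹ * y), memℓp_infty ⟨‖φ‖, by
    rintro _ ⟨y, rfl⟩
    exact lp.norm_apply_le_norm ENNReal.top_ne_zero φ _⟩⟩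

@[simp] theorem translate_apply (x : G) (φ : lp (fun _ : G => ℂ) ∞) (y : G) :
    translate x φ y = φ (x⁻¹ * y) := rfl

/-- A unital C*-subalgebra of `ℓ^∞(G)` (containing the constant function `1`) which is
invariant under translations. -/
structure InvariantSubalgebra (G : Type u) [Group G] extends
    StarSubalgebra ℂ (lp (fun _ : G => ℂ) ∞) where
  isClosed : IsClosed (toStarSubalgebra : Set (lp (fun _ : G => ℂ) ∞))
  translate_mem : ∀ (x : G), ∀ φ ∈ toStarSubalgebra, translate x φ ∈ toStarSubalgebra

/-- A (normalized) 2-cocycle of `G` with values in the unitary group of the translation-invariant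
C*-algebra `𝒜`. The value `ω(x, y; z)` is `ω x y z`. -/
structure TwoCocycle (𝒜 : InvariantSubalgebra G) where
  toFun : G → G → lp (fun _ : G => ℂ) ∞
  mem : ∀ x y, toFun x y ∈ 𝒜.toStarSubalgebra
  unitary : ∀ x y, toFun x y ∈ unitary (lp (fun _ : G => ℂ) ∞)
  cocycle : ∀ x y z,
    toFun x y * toFun (x * y) z = translate x (toFun y z) * toFun x (y * z)
  right_one : ∀ x, toFun x 1 = 1
  one_left : ∀ x, toFun 1 x = 1

instance (𝒜 : InvariantSubalgebra G) :
    CoeFun (TwoCocycle 𝒜) (fun _ => G → G → lp (fun _ : G => ℂ) ∞) := ⟨TwoCocycle.toFun⟩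

namespace TwoCocycle

variable {𝒜 : InvariantSubalgebra G} (ω : TwoCocycle 𝒜)

theorem norm_apply (x y z : G) : ‖ω x y z‖ = 1 := by
  have h := congrArg (fun φ : lp (fun _ : G => ℂ) ∞ => φ z)
    (Unitary.star_mul_self_of_mem (ω.unitary x y))
  simp only [lp.infty_coeFn_mul, lp.star_apply, Pi.mul_apply, lp.infty_coeFn_one,
    Pi.one_apply] at h
  have h2 := congrArg norm h
  rw [norm_mul, norm_star, norm_one] at h2
  nlinarith [norm_nonneg (ω x y z)]

theorem cocycle_apply (x y z t : G) :
    ω x y t * ω (x * y) z t = ω y z (x⁻¹ * t) * ω x (y * z) t := by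
  simpa using congrArg (fun φ : lp (fun _ : G => ℂ) ∞ => φ t) (ω.cocycle x y z)

/-- The weight `ω(xz⁻¹, zy⁻¹; x)`. -/
def weight (x z y : G) : ℂ := ω (x * z⁻¹) (z * y⁻¹) x

theorem norm_weight (x z y : G) : ‖ω.weight x z y‖ = 1 := ω.norm_apply _ _ _

theorem weight_cocycle (x b a y : G) :
    ω.weight x b a * ω.weight x a y = ω.weight b a y * ω.weight x b y := by
  have h := ω.cocycle_apply (x * b⁻¹) (b * a⁻¹) (a * y⁻¹) x
  simpa [weight, mul_assoc] using h

theorem weight_left (x y : G) : ω.weight x x y = 1 := by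
  simp [weight, ω.one_left]

theorem weight_right (x y : G) : ω.weight x y y = 1 := by
  simp [weight, ω.right_one]

theorem weight_symm (x y : G) : ω.weight x y x = ω.weight y x y := by
  simpa [weight_left, weight_right] using ω.weight_cocycle x y x y

theorem weight_star (x y z : G) : ω.weight x y x * ω.weight y z x * ω.weight x z y
    = ω.weight x z x * ω.weight z y z := by
  have h1 := ω.weight_cocycle x z y x
  have h2 := ω.weight_cocycle z y z x
  rw [weight_left, mul_one] at h2
  rw [h2]
  linear_combination (ω.weight y z x) * h1

theorem weight_mul_conj (x z y : G) :
    ω.weight x z y * star (ω.weight x z y) = 1 := by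
  have h := Complex.mul_conj (ω.weight x z y)
  rw [Complex.normSq_eq_norm_sq, ω.norm_weight] at h
  simpa using h

end TwoCocycle

/-! ## The algebra of scalar twisted kernels -/

/-- The space of scalar kernels `K : G × G → ℂ` dominated by some `k ∈ 𝓛(G)`, i.e.
`|K(x, y)| ≤ |k(xy⁻¹)|`, and such that `z ↦ K(xz, yz)` belongs to `𝒜` for all `x, y`. -/
def kernelSubmodule (L : AdmissibleAlgebra G) (𝒜 : InvariantSubalgebra G) :
    Submodule ℂ (G → G → ℂ) where
  carrier := {K | (∃ k ∈ L.carrier, ∀ x y, ‖K x y‖ ≤ ‖k (x * y⁻¹)‖) ∧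
    ∀ x y, ∃ φ ∈ 𝒜.toStarSubalgebra, ∀ z, φ z = K (x * z) (y * z)}
  zero_mem' := ⟨⟨0, L.carrier.zero_mem, by simp⟩, fun x y => ⟨0, zero_mem _, fun z => rfl⟩⟩
  add_mem' := by
    rintro K M ⟨⟨k, hk, hK⟩, hK'⟩ ⟨⟨m, hm, hM⟩, hM'⟩
    refine ⟨⟨_, L.carrier.add_mem (L.abs_mem hk) (L.abs_mem hm), fun x y => ?_⟩, fun x y => ?_⟩
    · simp only [AdmissibleAlgebra.abs, Pi.add_apply, ← Complex.ofReal_add, Complex.norm_real]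
      exact (norm_add_le _ _).trans ((add_le_add (hK x y) (hM x y)).trans (le_abs_self _))
    · obtain ⟨φ, hφ, h1⟩ := hK' x y
      obtain ⟨ψ, hψ, h2⟩ := hM' x y
      exact ⟨φ + ψ, add_mem hφ hψ, fun z => by simp [h1, h2]⟩
  smul_mem' := by
    rintro c K ⟨⟨k, hk, hK⟩, hK'⟩
    refine ⟨⟨_, L.carrier.smul_mem c hk, fun x y => ?_⟩, fun x y => ?_⟩
    · simp only [Pi.smul_apply, smul_eq_mul, norm_mul]
      exact mul_le_mul_of_nonneg_left (hK x y) (norm_nonneg _)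
    · obtain ⟨φ, hφ, h1⟩ := hK' x y
      exact ⟨c • φ, 𝒜.toStarSubalgebra.smul_mem hφ c, fun z => by simp [h1]⟩

/-- The algebra `𝔎^{𝓛,𝒜}_ω(G × G)` of scalar twisted kernels, with composition
`(K • M)(x, y) = ∑ z, K(x, z) M(z, y) ω(xz⁻¹, zy⁻¹; x)`, involution
`K•(x, y) = conj ω(xy⁻¹, yx⁻¹; x) conj K(y, x)`, and the norm
`‖K‖ = inf {‖k‖_𝓛 | |K(x, y)| ≤ |k(xy⁻¹)| for all x, y}`. -/
def KernelAlgebra (L : AdmissibleAlgebra G) (𝒜 : InvariantSubalgebra G) (_ω : TwoCocycle 𝒜) :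
    Type u :=
  ↥(kernelSubmodule L 𝒜)

namespace KernelAlgebra

variable {L : AdmissibleAlgebra G} {𝒜 : InvariantSubalgebra G} {ω : TwoCocycle 𝒜}

instance : AddCommGroup (KernelAlgebra L 𝒜 ω) :=
  inferInstanceAs (AddCommGroup (kernelSubmodule L 𝒜))

instance : Module ℂ (KernelAlgebra L 𝒜 ω) := inferInstanceAs (Module ℂ (kernelSubmodule L 𝒜))

/-- An element of the algebra from its underlying kernel. -/
def mk (K : G → G → ℂ) (hK : K ∈ kernelSubmodule L 𝒜) : KernelAlgebra L 𝒜 ω := ⟨K, hK⟩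

/-- The kernel underlying an element of the algebra. -/
def toFun (K : KernelAlgebra L 𝒜 ω) : G → G → ℂ := K.1

@[ext] theorem ext {K M : KernelAlgebra L 𝒜 ω} (h : K.toFun = M.toFun) : K = M := Subtype.ext h

@[simp] theorem toFun_mk (K : G → G → ℂ) (hK : K ∈ kernelSubmodule L 𝒜) :
    (mk K hK : KernelAlgebra L 𝒜 ω).toFun = K := rfl
@[simp] theorem toFun_add (K M : KernelAlgebra L 𝒜 ω) : (K + M).toFun = K.toFun + M.toFun := rfl
@[simp] theorem toFun_zero : (0 : KernelAlgebra L 𝒜 ω).toFun = 0 := rfl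
@[simp] theorem toFun_neg (K : KernelAlgebra L 𝒜 ω) : (-K).toFun = -K.toFun := rfl
@[simp] theorem toFun_sub (K M : KernelAlgebra L 𝒜 ω) : (K - M).toFun = K.toFun - M.toFun := rfl
@[simp] theorem toFun_smul (c : ℂ) (K : KernelAlgebra L 𝒜 ω) :
    (c • K).toFun = c • K.toFun := rfl

/-- The composition of twisted kernels. -/
def comp (ω : TwoCocycle 𝒜) (K M : G → G → ℂ) : G → G → ℂ :=
  fun x y => ∑' z, K x z * M z y * ω (x * z⁻¹) (z * y⁻¹) x

/-- The involution of twisted kernels. -/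
def adj (ω : TwoCocycle 𝒜) (K : G → G → ℂ) : G → G → ℂ :=
  fun x y => star (ω (x * y⁻¹) (y * x⁻¹) x) * star (K y x)

/-- The unit kernel. -/
def unitKernel : G → G → ℂ := fun x y => Set.indicator {(1 : G)} (fun _ => (1 : ℂ)) (x * y⁻¹)

theorem comp_eq_wmul (K M : G → G → ℂ) : comp ω K M = wmul ω.weight K M := by
  funext x y
  refine tsum_congr fun z => ?_
  simp [TwoCocycle.weight, mul_comm]

theorem summable_comp {K M : G → G → ℂ} {k m : G → ℂ} (hk : k ∈ L.carrier) (hm : m ∈ L.carrier)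
    (hK : ∀ x y, ‖K x y‖ ≤ ‖k (x * y⁻¹)‖) (hM : ∀ x y, ‖M x y‖ ≤ ‖m (x * y⁻¹)‖) (x y : G) :
    Summable fun z => K x z * M z y * ω (x * z⁻¹) (z * y⁻¹) x := by
  refine (summable_wmul ω.norm_weight (fun x => norm_nonneg (k x)) (fun x => norm_nonneg (m x))
    (L.summable k hk) (L.summable m hm) hK hM x y).congr fun z => ?_
  simp [TwoCocycle.weight, mul_comm]

theorem norm_comp_le {K M : G → G → ℂ} {k m : G → ℂ} (hk : k ∈ L.carrier) (hm : m ∈ L.carrier)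
    (hK : ∀ x y, ‖K x y‖ ≤ ‖k (x * y⁻¹)‖) (hM : ∀ x y, ‖M x y‖ ≤ ‖m (x * y⁻¹)‖) (x y : G) :
    ‖comp ω K M x y‖ ≤
      ‖conv (AdmissibleAlgebra.abs k) (AdmissibleAlgebra.abs m) (x * y⁻¹)‖ := by
  rw [AdmissibleAlgebra.norm_conv_abs]
  have hs := summable_dom (fun x => norm_nonneg (k x)) (fun x => norm_nonneg (m x))
    (L.summable k hk) (L.summable m hm) x y
  have e : ∑' z, ‖k (x * z⁻¹)‖ * ‖m (z * y⁻¹)‖ = ∑' z, ‖k z‖ * ‖m (z⁻¹ * (x * y⁻¹))‖ := by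
    rw [← ((Equiv.inv G).trans (Equiv.mulLeft x)).tsum_eq
      (fun z => ‖k z‖ * ‖m (z⁻¹ * (x * y⁻¹))‖)]
    refine tsum_congr fun z => ?_
    simp [mul_assoc]
  rw [← e, comp_eq_wmul]
  exact tsum_of_norm_bounded hs.hasSum fun z =>
    norm_wmul_term (k := fun x => ‖k x‖) (l := fun x => ‖m x‖) ω.norm_weight hK hM x y z

theorem comp_mem {K M : G → G → ℂ} (hK : K ∈ kernelSubmodule L 𝒜)
    (hM : M ∈ kernelSubmodule L 𝒜) : comp ω K M ∈ kernelSubmodule L 𝒜 := by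
  obtain ⟨⟨k, hk, hK⟩, hK'⟩ := hK
  obtain ⟨⟨m, hm, hM⟩, hM'⟩ := hM
  refine ⟨⟨_, L.conv_abs_mem hk hm, norm_comp_le hk hm hK hM⟩, fun x y => ?_⟩
  choose φ hφ hφK using fun v => hK' x v
  choose ψ hψ hψM using fun v => hM' v y
  let T : G → lp (fun _ : G => ℂ) ∞ := fun v =>
    φ v * ψ v * translate x⁻¹ (ω (x * v⁻¹) (v * y⁻¹))
  have hTz : ∀ v z, T v z = K (x * z) (v * z) * M (v * z) (y * z)
      * ω (x * z * (v * z)⁻¹) (v * z * (y * z)⁻¹) (x * z) := by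
    intro v z
    simp [T, hφK, hψM, mul_assoc]
  have hTmem : ∀ v, T v ∈ 𝒜.toStarSubalgebra := fun v =>
    mul_mem (mul_mem (hφ v) (hψ v)) (𝒜.translate_mem _ _ (ω.mem _ _))
  have hTs : Summable T := by
    refine Summable.of_norm_bounded (summable_dom (fun x => norm_nonneg (k x))
      (fun x => norm_nonneg (m x)) (L.summable k hk) (L.summable m hm) x y) fun v => ?_
    refine lp.norm_le_of_forall_le (by positivity) fun z => ?_
    rw [hTz, norm_mul, norm_mul, ω.norm_apply, mul_one]
    have h1 := hK (x * z) (v * z)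
    have h2 := hM (v * z) (y * z)
    simp only [mul_inv_rev, mul_assoc, mul_inv_cancel_left] at h1 h2
    exact mul_le_mul h1 h2 (norm_nonneg _) (norm_nonneg _)
  refine ⟨∑' v, T v, 𝒜.isClosed.mem_of_tendsto hTs.hasSum
    (Filter.Eventually.of_forall fun s => sum_mem fun i _ => hTmem i), fun z => ?_⟩
  have hz : HasSum (fun v => T v z) ((∑' v, T v) z) :=
    hTs.hasSum.map (lp.evalCLM ℂ (fun _ : G => ℂ) ∞ z) (lp.evalCLM ℂ (fun _ : G => ℂ) ∞ z).continuous
  rw [← hz.tsum_eq]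
  unfold comp
  rw [← (Equiv.mulRight z).tsum_eq (fun v => K (x * z) v * M v (y * z)
      * ω (x * z * v⁻¹) (v * (y * z)⁻¹) (x * z))]
  exact tsum_congr fun v => hTz v z

theorem adj_mem {K : G → G → ℂ} (hK : K ∈ kernelSubmodule L 𝒜) :
    adj ω K ∈ kernelSubmodule L 𝒜 := by
  obtain ⟨⟨k, hk, hK⟩, hK'⟩ := hK
  refine ⟨⟨_, L.invol_mem k hk, fun x y => ?_⟩, fun x y => ?_⟩
  · simpa [adj, invol, ω.norm_apply] using hK y x
  · obtain ⟨φ, hφ, h⟩ := hK' y x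
    refine ⟨star (translate x⁻¹ (ω (x * y⁻¹) (y * x⁻¹))) * star φ,
      mul_mem (star_mem (𝒜.translate_mem _ _ (ω.mem _ _))) (star_mem hφ), fun z => ?_⟩
    simp [adj, h, mul_assoc]

theorem unitKernel_mem : (unitKernel : G → G → ℂ) ∈ kernelSubmodule L 𝒜 := by
  refine ⟨⟨_, L.one_mem, fun x y => le_rfl⟩, fun x y => ?_⟩
  refine ⟨(Set.indicator {(1 : G)} (fun _ => (1 : ℂ)) (x * y⁻¹)) • 1,
    𝒜.toStarSubalgebra.smul_mem (one_mem _) _, fun z => ?_⟩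
  simp [unitKernel, mul_assoc]

instance : Mul (KernelAlgebra L 𝒜 ω) := 
  ⟨fun K M => mk (comp ω K.toFun M.toFun) (comp_mem K.2 M.2)⟩

instance : Star (KernelAlgebra L 𝒜 ω) := ⟨fun K => mk (adj ω K.toFun) (adj_mem K.2)⟩

instance : One (KernelAlgebra L 𝒜 ω) := ⟨mk unitKernel unitKernel_mem⟩

@[simp] theorem toFun_mul (K M : KernelAlgebra L 𝒜 ω) :
    (K * M).toFun = comp ω K.toFun M.toFun := rfl
@[simp] theorem toFun_star (K : KernelAlgebra L 𝒜 ω) : (star K).toFun = adj ω K.toFun := rfl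
@[simp] theorem toFun_one : (1 : KernelAlgebra L 𝒜 ω).toFun = unitKernel := rfl

theorem exists_dom (K : KernelAlgebra L 𝒜 ω) :
    ∃ k ∈ L.carrier, ∀ x y, ‖K.toFun x y‖ ≤ ‖k (x * y⁻¹)‖ := K.2.1

theorem summable_mul (K M : KernelAlgebra L 𝒜 ω) (x y : G) :
    Summable fun z => K.toFun x z * M.toFun z y * ω (x * z⁻¹) (z * y⁻¹) x := by
  obtain ⟨k, hk, hK⟩ := K.exists_dom
  obtain ⟨m, hm, hM⟩ := M.exists_dom
  exact summable_comp hk hm hK hM x y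

theorem unitKernel_self (x : G) : unitKernel x x = 1 := by simp [unitKernel]

theorem unitKernel_ne {x y : G} (h : x ≠ y) : unitKernel x y = 0 := by
  have : x * y⁻¹ ≠ 1 := fun h' => h (mul_inv_eq_one.1 h')
  simp [unitKernel, this]

instance : Ring (KernelAlgebra L 𝒜 ω) :=
  { (inferInstance : AddCommGroup (KernelAlgebra L 𝒜 ω)),
    (inferInstance : Mul (KernelAlgebra L 𝒜 ω)),
    (inferInstance : One (KernelAlgebra L 𝒜 ω)) with
    left_distrib := fun K M N => by
      ext x y
      simp only [toFun_mul, toFun_add, comp, Pi.add_apply, mul_add, add_mul]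
      exact (summable_mul K M x y).tsum_add (summable_mul K N x y)
    right_distrib := fun K M N => by
      ext x y
      simp only [toFun_mul, toFun_add, comp, Pi.add_apply, add_mul]
      exact (summable_mul K N x y).tsum_add (summable_mul M N x y)
    zero_mul := fun K => by ext x y; simp [comp]
    mul_zero := fun K => by ext x y; simp [comp]
    mul_assoc := fun K M N => by
      obtain ⟨k, hk, hK⟩ := K.exists_dom
      obtain ⟨m, hm, hM⟩ := M.exists_dom
      obtain ⟨n, hn, hN⟩ := N.exists_dom
      apply ext
      simp only [toFun_mul, comp_eq_wmul]
      exact wmul_assoc ω.norm_weight ω.weight_cocycle (fun x => norm_nonneg (k x))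
        (fun x => norm_nonneg (m x)) (fun x => norm_nonneg (n x)) (L.summable k hk)
        (L.summable m hm) (L.summable n hn) hK hM hN
    one_mul := fun K => by
      ext x y
      simp only [toFun_mul, toFun_one, comp]
      rw [tsum_eq_single x fun z hz => by rw [unitKernel_ne hz.symm, zero_mul, zero_mul]]
      simp [unitKernel_self, ω.one_left]
    mul_one := fun K => by
      ext x y
      simp only [toFun_mul, toFun_one, comp]
      rw [tsum_eq_single y fun z hz => by rw [unitKernel_ne hz, mul_zero, zero_mul]]
      simp [unitKernel_self, ω.right_one]
    zsmul := (inferInstance : AddCommGroup (KernelAlgebra L 𝒜 ω)).zsmul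
    neg_add_cancel := neg_add_cancel }

theorem adj_eq (K : G → G → ℂ) (x y : G) :
    adj ω K x y = star (ω.weight x y x) * star (K y x) := rfl

instance : StarRing (KernelAlgebra L 𝒜 ω) where
  star_involutive := fun K => by
    ext x y
    simp only [toFun_star, adj_eq, star_mul', star_star]
    rw [ω.weight_symm y x, ← mul_assoc, mul_comm (star _), ω.weight_mul_conj, one_mul]
  star_mul := fun K M => by
    ext x y
    simp only [toFun_star, toFun_mul, adj_eq, comp_eq_wmul, wmul]
    rw [tsum_star, ← tsum_mul_left]
    refine tsum_congr fun z => ?_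
    have h := congrArg star (ω.weight_star x y z)
    simp only [star_mul'] at h
    have h' := ω.weight_mul_conj x z y
    simp only [smul_eq_mul, star_mul']
    linear_combination (star (K.toFun y z) * star (M.toFun z x) * ω.weight x z y) * h
      - (star (ω.weight x y x) * star (ω.weight y z x) * star (K.toFun y z)
        * star (M.toFun z x)) * h'
  star_add := fun K M => by ext x y; simp [adj_eq, mul_add]

instance : StarModule ℂ (KernelAlgebra L 𝒜 ω) where
  star_smul := fun c K => by ext x y; simp [adj_eq, mul_left_comm]

instance : Algebra ℂ (KernelAlgebra L 𝒜 ω) :=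
  Algebra.ofModule
    (fun c K M => by
      ext x y
      simp only [toFun_mul, toFun_smul, comp, Pi.smul_apply, smul_eq_mul, mul_assoc]
      exact tsum_mul_left)
    (fun c K M => by
      ext x y
      simp only [toFun_mul, toFun_smul, comp, Pi.smul_apply, smul_eq_mul]
      rw [← tsum_mul_left]
      exact tsum_congr fun z => by ring)

instance : Norm (KernelAlgebra L 𝒜 ω) :=
  ⟨fun K => sInf {r | ∃ k ∈ L.carrier, (∀ x y, ‖K.toFun x y‖ ≤ ‖k (x * y⁻¹)‖) ∧ r = L.nrm k}⟩

theorem norm_def (K : KernelAlgebra L 𝒜 ω) : ‖K‖ =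
    sInf {r | ∃ k ∈ L.carrier, (∀ x y, ‖K.toFun x y‖ ≤ ‖k (x * y⁻¹)‖) ∧ r = L.nrm k} := rfl

theorem norm_le (K : KernelAlgebra L 𝒜 ω) {k : G → ℂ} (hk : k ∈ L.carrier)
    (h : ∀ x y, ‖K.toFun x y‖ ≤ ‖k (x * y⁻¹)‖) : ‖K‖ ≤ L.nrm k := by
  rw [norm_def]
  refine csInf_le ⟨0, ?_⟩ ⟨k, hk, h, rfl⟩
  rintro _ ⟨k, hk, -, rfl⟩
  exact L.nrm_nonneg hk

theorem exists_dom_lt (K : KernelAlgebra L 𝒜 ω) {ε : ℝ} (hε : 0 < ε) :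
    ∃ k ∈ L.carrier, (∀ x y, ‖K.toFun x y‖ ≤ ‖k (x * y⁻¹)‖) ∧ L.nrm k < ‖K‖ + ε := by
  obtain ⟨k, hk, hK⟩ := K.exists_dom
  have hne : {r | ∃ k ∈ L.carrier, (∀ x y, ‖K.toFun x y‖ ≤ ‖k (x * y⁻¹)‖) ∧ r = L.nrm k}.Nonempty :=
    ⟨L.nrm k, k, hk, hK, rfl⟩
  obtain ⟨_, ⟨k, hk, h, rfl⟩, hlt⟩ := exists_lt_of_csInf_lt (b := ‖K‖ + ε) hne
    (by rw [← norm_def]; linarith)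
  exact ⟨k, hk, h, hlt⟩

theorem norm_nonneg' (K : KernelAlgebra L 𝒜 ω) : 0 ≤ ‖K‖ := by
  refine Real.sInf_nonneg ?_
  rintro _ ⟨k, hk, -, rfl⟩
  exact L.nrm_nonneg hk

theorem norm_smul_le' (c : ℂ) (K : KernelAlgebra L 𝒜 ω) : ‖c • K‖ ≤ ‖c‖ * ‖K‖ := by
  refine le_of_forall_pos_le_add fun ε hε => ?_
  have hc : 0 < ‖c‖ + 1 := by positivity
  obtain ⟨k, hk, h, hlt⟩ := K.exists_dom_lt (div_pos hε hc)
  refine (norm_le _ (L.carrier.smul_mem c hk) fun x y => ?_).trans ?_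
  · simp only [toFun_smul, Pi.smul_apply, norm_smul]
    exact mul_le_mul_of_nonneg_left (h x y) (norm_nonneg _)
  · rw [L.nrm_smul c k hk]
    have h1 : ‖c‖ * (ε / (‖c‖ + 1)) ≤ ε := by
      rw [mul_div_assoc', div_le_iff₀ hc]
      nlinarith [norm_nonneg c]
    nlinarith [norm_nonneg c]

theorem normCore : NormedSpace.Core ℂ (KernelAlgebra L 𝒜 ω) where
  norm_nonneg := norm_nonneg'
  norm_smul := fun c K => by
    refine le_antisymm (norm_smul_le' c K) ?_
    rcases eq_or_ne c 0 with rfl | hc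
    · simpa using norm_nonneg' _
    · have h := norm_smul_le' c⁻¹ (c • K)
      rw [smul_smul, inv_mul_cancel₀ hc, one_smul, norm_inv] at h
      have hc' : 0 < ‖c‖ := norm_pos_iff.2 hc
      rwa [inv_mul_eq_div, le_div_iff₀ hc', mul_comm] at h
  norm_triangle := fun K M => by
    refine le_of_forall_pos_le_add fun ε hε => ?_
    obtain ⟨k, hk, hK, hkl⟩ := K.exists_dom_lt (half_pos hε)
    obtain ⟨m, hm, hM, hml⟩ := M.exists_dom_lt (half_pos hε)
    refine (norm_le _ (L.carrier.add_mem (L.abs_mem hk) (L.abs_mem hm)) fun x y => ?_).trans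
      ((L.nrm_add_le _ (L.abs_mem hk) _ (L.abs_mem hm)).trans ?_)
    · simp only [AdmissibleAlgebra.abs, toFun_add, Pi.add_apply, ← Complex.ofReal_add,
        Complex.norm_real]
      exact (norm_add_le _ _).trans ((add_le_add (hK x y) (hM x y)).trans (le_abs_self _))
    · rw [L.nrm_abs hk, L.nrm_abs hm]
      linarith
  norm_eq_zero_iff := fun K => by
    constructor
    · intro h
      obtain ⟨C, hC0, hC⟩ := L.exists_bound
      ext x y
      have : ‖K.toFun x y‖ ≤ 0 := by
        refine le_of_forall_pos_le_add fun ε hε => ?_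
        obtain ⟨k, hk, hK, hkl⟩ := K.exists_dom_lt (ε := ε / (C + 1)) (by positivity)
        rw [h, zero_add] at hkl
        refine ((hK x y).trans (hC k hk _)).trans ?_
        have h1 : (C + 1) * (ε / (C + 1)) = ε := by field_simp
        nlinarith [L.nrm_nonneg hk]
      simpa using this
    · rintro rfl
      refine le_antisymm ?_ (norm_nonneg' _)
      have := norm_le (0 : KernelAlgebra L 𝒜 ω) L.carrier.zero_mem (by simp)
      rwa [L.nrm_zero] at this

instance : NormedAddCommGroup (KernelAlgebra L 𝒜 ω) := NormedAddCommGroup.ofCore normCore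

instance : NormedRing (KernelAlgebra L 𝒜 ω) :=
  { (inferInstance : NormedAddCommGroup (KernelAlgebra L 𝒜 ω)),
    (inferInstance : Ring (KernelAlgebra L 𝒜 ω)) with
    norm_mul_le := fun K M => by
      refine le_of_forall_pos_le_add fun ε hε => ?_
      have hc : 0 < ‖K‖ + ‖M‖ + 1 := by positivity
      obtain ⟨δ, hδ, hδ1, hδε⟩ : ∃ δ : ℝ, 0 < δ ∧ δ ≤ 1 ∧ δ * (‖K‖ + ‖M‖ + 1) ≤ ε := by
        refine ⟨min 1 (ε / (‖K‖ + ‖M‖ + 1)), lt_min one_pos (by positivity), min_le_left _ _, ?_⟩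
        exact (mul_le_mul_of_nonneg_right (min_le_right _ _) hc.le).trans
          (div_mul_cancel₀ _ hc.ne').le
      obtain ⟨k, hk, hK, hkl⟩ := K.exists_dom_lt hδ
      obtain ⟨m, hm, hM, hml⟩ := M.exists_dom_lt hδ
      refine (norm_le (K * M) (L.conv_abs_mem hk hm) (norm_comp_le hk hm hK hM)).trans
        ((L.nrm_conv_abs_le hk hm).trans ?_)
      refine (mul_le_mul hkl.le hml.le (L.nrm_nonneg hm) (by positivity)).trans ?_
      nlinarith }

instance : NormedAlgebra ℂ (KernelAlgebra L 𝒜 ω) where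
  norm_smul_le := norm_smul_le'

instance : NormedStarGroup (KernelAlgebra L 𝒜 ω) where
  norm_star_le := fun K => by
    refine le_of_forall_pos_le_add fun ε hε => ?_
    obtain ⟨k, hk, hK, hkl⟩ := K.exists_dom_lt hε
    refine (norm_le (star K) (L.invol_mem k hk) fun x y => ?_).trans
      ((L.nrm_invol k hk).le.trans hkl.le)
    simpa [adj, invol, ω.norm_apply] using hK y x

theorem toFun_sum (u : ℕ → KernelAlgebra L 𝒜 ω) (s : Finset ℕ) (x y : G) :
    (∑ i ∈ s, u i).toFun x y = ∑ i ∈ s, (u i).toFun x y := by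
  classical
  induction s using Finset.induction_on with
  | empty => simp
  | insert a s ha ih => simp [Finset.sum_insert ha, ih]

instance : CompleteSpace (KernelAlgebra L 𝒜 ω) := by
  refine NormedAddCommGroup.completeSpace_of_summable_imp_tendsto fun u hu => ?_
  choose κ hκ hdom hlt using fun n => (u n).exists_dom_lt (ε := (1 / 2) ^ n) (by positivity)
  have hnrm : Summable fun n => L.nrm (AdmissibleAlgebra.abs (κ n)) := by
    refine Summable.of_nonneg_of_le (fun n => L.nrm_nonneg (L.abs_mem (hκ n))) (fun n => ?_)
      (hu.add summable_geometric_two)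
    rw [L.nrm_abs (hκ n)]
    exact (hlt n).le
  obtain ⟨k, hk, hsx, hkx, hlim⟩ := L.exists_sum (fun n => L.abs_mem (hκ n)) hnrm
  simp only [AdmissibleAlgebra.norm_abs] at hsx
  have hkx' : ∀ x, k x = ((∑' n, ‖κ n x‖ : ℝ) : ℂ) := fun x => by
    rw [← (hkx x).tsum_eq, Complex.ofReal_tsum]; rfl
  have hsu : ∀ x y, Summable fun n => ‖(u n).toFun x y‖ := fun x y =>
    Summable.of_nonneg_of_le (fun n => norm_nonneg _) (fun n => hdom n x y) (hsx (x * y⁻¹))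
  have hmem : (fun x y => ∑' n, (u n).toFun x y) ∈ kernelSubmodule L 𝒜 := by
    refine ⟨⟨k, hk, fun x y => ?_⟩, fun x y => ?_⟩
    · rw [hkx', Complex.norm_real, Real.norm_eq_abs]
      exact (tsum_of_norm_bounded (hsx (x * y⁻¹)).hasSum fun n => hdom n x y).trans
        (le_abs_self _)
    · choose T hTmem hTz using fun n => (u n).2.2 x y
      have hTs : Summable T := by
        refine Summable.of_norm_bounded (hsx (x * y⁻¹)) fun n => ?_
        refine lp.norm_le_of_forall_le (norm_nonneg _) fun z => ?_
        have h1 := hdom n (x * z) (y * z)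
        simp only [mul_inv_rev, mul_assoc, mul_inv_cancel_left] at h1
        rw [hTz]
        exact h1
      refine ⟨∑' n, T n, 𝒜.isClosed.mem_of_tendsto hTs.hasSum
        (Filter.Eventually.of_forall fun s => sum_mem fun i _ => hTmem i), fun z => ?_⟩
      have hz : HasSum (fun n => T n z) ((∑' n, T n) z) :=
        hTs.hasSum.map (lp.evalCLM ℂ (fun _ : G => ℂ) ∞ z)
          (lp.evalCLM ℂ (fun _ : G => ℂ) ∞ z).continuous
      rw [← hz.tsum_eq]
      exact tsum_congr fun n => hTz n z
  refine ⟨mk _ hmem, ?_⟩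
  rw [tendsto_iff_norm_sub_tendsto_zero]
  refine squeeze_zero (fun n => norm_nonneg _) (fun n => ?_) hlim
  rw [norm_sub_rev]
  refine norm_le _ (L.carrier.sub_mem hk
    (L.carrier.sum_mem fun i _ => L.abs_mem (hκ i))) fun x y => ?_
  have e1 : (k - ∑ i ∈ Finset.range n, AdmissibleAlgebra.abs (κ i)) (x * y⁻¹)
      = ((∑' i, ‖κ (i + n) (x * y⁻¹)‖ : ℝ) : ℂ) := by
    rw [Pi.sub_apply, hkx', ← (hsx (x * y⁻¹)).sum_add_tsum_nat_add n]
    simp [AdmissibleAlgebra.abs, Finset.sum_apply]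
  rw [e1, Complex.norm_real, Real.norm_eq_abs, toFun_sub, Pi.sub_apply, Pi.sub_apply, toFun_sum]
  change ‖∑' i, (u i).toFun x y - _‖ ≤ _
  rw [← (hsu x y).of_norm.sum_add_tsum_nat_add n, add_sub_cancel_left]
  exact (tsum_of_norm_bounded ((summable_nat_add_iff n).2 (hsx (x * y⁻¹))).hasSum
    fun i => hdom (i + n) x y).trans (le_abs_self _)

end KernelAlgebra

end Kernel

end TwistedKernel

end

/-! Symmetry passes to closed `*`-subalgebras of a Banach `*`-algebra: a subset of `[0, ∞)` has
connected complement in `ℂ`, so passing to a closed subalgebra cannot enlarge such a spectrum. It is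
therefore enough to embed the twisted kernels isometrically in `𝓛(G; B(ℓ²(G)))`.

Over the coefficients `ℓ^∞(G)` the cocycle becomes a coboundary: with `γ(x, y) = ω(xy⁻¹, y; x)`, the
cocycle identity says `γ(x, z) γ(z, y) = ω(xz⁻¹, zy⁻¹; x) γ(x, y)`, so multiplication by `γ` turns
the twisted composition of kernels into the ordinary one. An untwisted kernel is the sum of its
diagonals `K_g(x) = K(x, g⁻¹x) γ(x, g⁻¹x)`, and `K ↦ (g ↦ M_{K_g} λ_g)` is the desired embedding,
where `M` denotes multiplication operators and `λ` the left regular representation. -/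

noncomputable section

namespace TwistedKernel

theorem isPreconnected_compl_of_forall_nonneg {s : Set ℂ} (hs : ∀ z ∈ s, 0 ≤ z) :
    IsPreconnected sᶜ := by
  have hslit : IsPreconnected (-Complex.slitPlane) := by
    rw [← Set.image_neg_eq_neg]
    exact (Complex.starConvex_one_slitPlane.isPathConnected
      Complex.one_mem_slitPlane).isConnected.isPreconnected.image _ continuous_neg.continuousOn
  refine hslit.subset_closure (fun z hz hzs => ?_) fun z _ => ?_
  · exact Complex.mem_slitPlane_iff_not_le_zero.1 hz (neg_nonpos.2 (hs z hzs))
  · by_cases hz : -z ∈ Complex.slitPlane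
    · exact subset_closure hz
    · have him : z ∈ closure {w : ℂ | 0 < w.im} := by
        rw [Complex.mem_slitPlane_iff_not_le_zero, not_not, neg_nonpos] at hz
        rw [Complex.closure_setOfPred_lt_im]
        exact (Complex.le_def.1 hz).2.le
      exact closure_mono (fun w hw => Or.inr (by simpa using ne_of_gt hw)) him

theorem spectrum_eq_of_isometry {𝕜 A B : Type*} [NontriviallyNormedField 𝕜]
    [NormedRing A] [NormedAlgebra 𝕜 A] [CompleteSpace A]
    [NormedRing B] [NormedAlgebra 𝕜 B] [CompleteSpace B] {φ : A →ₐ[𝕜] B} (hφ : Isometry φ)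
    {a : A} (ha : IsPreconnected (spectrum 𝕜 (φ a))ᶜ) : spectrum 𝕜 a = spectrum 𝕜 (φ a) := by
  have hclosed : IsClosed (φ.range : Set B) := hφ.isClosedEmbedding.isClosed_range
  let e : A ≃ₐ[𝕜] φ.range := AlgEquiv.ofInjective φ hφ.injective
  rw [← AlgEquiv.spectrum_eq e]
  exact Subalgebra.spectrum_eq_of_isPreconnected_compl φ.range (e a) ha

section Unitization

variable {𝕜 A B : Type*} [NontriviallyNormedField 𝕜]
  [NonUnitalNormedRing A] [NormedSpace 𝕜 A] [IsScalarTower 𝕜 A A] [SMulCommClass 𝕜 A A]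
  [NonUnitalNormedRing B] [NormedSpace 𝕜 B] [IsScalarTower 𝕜 B B] [SMulCommClass 𝕜 B B]

/-- The unital extension of `φ` to the unitizations. They carry the `ℓ¹` norm, for which the
extension of an isometry is again an isometry. -/
def unitizationMap (φ : A →ₙₐ[𝕜] B) :
    WithLp 1 (Unitization 𝕜 A) →ₐ[𝕜] WithLp 1 (Unitization 𝕜 B) :=
  (WithLp.unitizationAlgEquiv 𝕜).symm.toAlgHom.comp
    ((Unitization.lift ((Unitization.inrNonUnitalAlgHom 𝕜 B).comp φ)).comp
      (WithLp.unitizationAlgEquiv 𝕜).toAlgHom)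

theorem unitizationMap_inr (φ : A →ₙₐ[𝕜] B) (a : A) :
    unitizationMap φ (WithLp.toLp 1 (a : Unitization 𝕜 A)) =
      WithLp.toLp 1 (φ a : Unitization 𝕜 B) := by
  simp [unitizationMap, WithLp.unitizationAlgEquiv]

theorem isometry_unitizationMap {φ : A →ₙₐ[𝕜] B} (hφ : Isometry φ) :
    Isometry (unitizationMap φ) := by
  refine AddMonoidHomClass.isometry_of_norm _ fun x => ?_
  have hnorm (a : A) : ‖φ a‖ = ‖a‖ := hφ.norm_map_of_map_zero (map_zero φ) a
  simp [WithLp.unitization_norm_def, unitizationMap, Unitization.algebraMap_eq_inl, hnorm]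

theorem quasispectrum_eq_of_isometry [CompleteSpace 𝕜] [CompleteSpace A] [CompleteSpace B]
    {φ : A →ₙₐ[𝕜] B} (hφ : Isometry φ) {a : A}
    (ha : IsPreconnected (quasispectrum 𝕜 (φ a))ᶜ) :
    quasispectrum 𝕜 a = quasispectrum 𝕜 (φ a) := by
  have hA : quasispectrum 𝕜 a = spectrum 𝕜 (WithLp.toLp 1 (a : Unitization 𝕜 A)) := by
    rw [Unitization.quasispectrum_eq_spectrum_inr]
    exact (AlgEquiv.spectrum_eq (WithLp.unitizationAlgEquiv 𝕜).symm (a : Unitization 𝕜 A)).symm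
  have hB : quasispectrum 𝕜 (φ a) =
      spectrum 𝕜 (unitizationMap φ (WithLp.toLp 1 (a : Unitization 𝕜 A))) := by
    rw [Unitization.quasispectrum_eq_spectrum_inr, unitizationMap_inr]
    exact (AlgEquiv.spectrum_eq (WithLp.unitizationAlgEquiv 𝕜).symm (φ a : Unitization 𝕜 B)).symm
  rw [hA, hB]
  exact spectrum_eq_of_isometry (isometry_unitizationMap hφ) (hB ▸ ha)

end Unitization

theorem IsSymmetric.of_isometry {A B : Type*}
    [NonUnitalNormedRing A] [CompleteSpace A] [NormedSpace ℂ A] [IsScalarTower ℂ A A]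
    [SMulCommClass ℂ A A] [StarRing A] [StarModule ℂ A] [NormedStarGroup A]
    [NonUnitalNormedRing B] [CompleteSpace B] [NormedSpace ℂ B] [IsScalarTower ℂ B B]
    [SMulCommClass ℂ B B] [StarRing B] [StarModule ℂ B] [NormedStarGroup B]
    {φ : A →⋆ₙₐ[ℂ] B} (hφ : Isometry φ) (hB : IsSymmetric B) : IsSymmetric A := by
  intro a
  have hnonneg : ∀ z ∈ quasispectrum ℂ (φ (star a * a)), 0 ≤ z := by
    rw [map_mul, map_star]
    exact hB (φ a)
  have heq : quasispectrum ℂ (star a * a) = quasispectrum ℂ (φ (star a * a)) :=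
    quasispectrum_eq_of_isometry (φ := (φ : A →ₙₐ[ℂ] B)) hφ
      (isPreconnected_compl_of_forall_nonneg hnonneg)
  rwa [heq]

section HilbertSpace

variable {ι : Type*}

/-- The representation of `ℓ^∞(ι)` on `ℓ²(ι)` by multiplication operators. -/
def mulOperator :
    lp (fun _ : ι => ℂ) ∞ →⋆ₙₐ[ℂ] lp (fun _ : ι => ℂ) 2 →L[ℂ] lp (fun _ : ι => ℂ) 2 where
  toFun := lp.holderL 2 (K := 1) (fun _ => ContinuousLinearMap.mul ℂ ℂ) (by simp)
  map_smul' := map_smul _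
  map_zero' := map_zero _
  map_add' := map_add _
  map_mul' φ ψ := by ext ξ x; exact mul_assoc (φ x) (ψ x) (ξ x)
  map_star' φ := by
    rw [ContinuousLinearMap.star_eq_adjoint, ContinuousLinearMap.eq_adjoint_iff]
    intro ξ η
    rw [lp.inner_eq_tsum, lp.inner_eq_tsum]
    refine tsum_congr fun x => ?_
    change η x * star (star (φ x) * ξ x) = φ x * η x * star (ξ x)
    rw [star_mul', star_star]
    ring

@[simp] theorem mulOperator_apply (φ : lp (fun _ : ι => ℂ) ∞) (ξ : lp (fun _ : ι => ℂ) 2)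
    (x : ι) : mulOperator φ ξ x = φ x * ξ x := rfl

theorem mulOperator_injective : Function.Injective (mulOperator (ι := ι)) := by
  classical
  intro φ ψ h
  ext x
  simpa using congrArg (fun T => T (lp.single 2 x 1) x) h

theorem norm_mulOperator (φ : lp (fun _ : ι => ℂ) ∞) : ‖mulOperator φ‖ = ‖φ‖ :=
  NonUnitalStarAlgHom.norm_map mulOperator mulOperator_injective φ

variable {G : Type u} [Group G]

theorem hasSum_norm_sq_leftTranslate (g : G) (ξ : lp (fun _ : G => ℂ) 2) :
    HasSum (fun x => ‖ξ (g⁻¹ * x)‖ ^ (2 : ℝ≥0∞).toReal) (‖ξ‖ ^ (2 : ℝ≥0∞).toReal) :=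
  (Equiv.mulLeft g⁻¹).hasSum_iff.2 (lp.hasSum_norm (by simp) ξ)

/-- Left translation by `g` as an isometry of `ℓ²(G)`. -/
def leftTranslate (g : G) : lp (fun _ : G => ℂ) 2 →ₗᵢ[ℂ] lp (fun _ : G => ℂ) 2 where
  toFun ξ := ⟨fun x => ξ (g⁻¹ * x), memℓp_gen (hasSum_norm_sq_leftTranslate g ξ).summable⟩
  map_add' _ _ := rfl
  map_smul' _ _ := rfl
  norm_map' ξ := (Real.rpow_left_inj (norm_nonneg _) (norm_nonneg _) (by simp)).1 <|
    (lp.hasSum_norm (by simp) _).unique (hasSum_norm_sq_leftTranslate g ξ)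

@[simp] theorem leftTranslate_apply (g : G) (ξ : lp (fun _ : G => ℂ) 2) (x : G) :
    leftTranslate g ξ x = ξ (g⁻¹ * x) := rfl

theorem leftTranslate_mul (g h : G) (ξ : lp (fun _ : G => ℂ) 2) :
    leftTranslate (g * h) ξ = leftTranslate g (leftTranslate h ξ) := by
  ext x
  simp [mul_assoc]

theorem leftTranslate_one (ξ : lp (fun _ : G => ℂ) 2) : leftTranslate (1 : G) ξ = ξ := by
  ext x
  simp

theorem leftTranslate_surjective (g : G) : Function.Surjective (leftTranslate g) := fun ξ =>
  ⟨leftTranslate g⁻¹ ξ, by rw [← leftTranslate_mul, mul_inv_cancel, leftTranslate_one]⟩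

/-- The left regular representation of `G` on `ℓ²(G)`. -/
def leftRegular : G →* unitary (lp (fun _ : G => ℂ) 2 →L[ℂ] lp (fun _ : G => ℂ) 2) :=
  Unitary.linearIsometryEquiv.symm.toMonoidHom.comp <| MonoidHom.mk'
    (fun g => LinearIsometryEquiv.ofSurjective (leftTranslate g) (leftTranslate_surjective g))
    fun g h => LinearIsometryEquiv.ext (leftTranslate_mul g h)

@[simp] theorem leftRegular_apply (g : G) (ξ : lp (fun _ : G => ℂ) 2) (x : G) :
    (leftRegular g : lp (fun _ : G => ℂ) 2 →L[ℂ] lp (fun _ : G => ℂ) 2) ξ x = ξ (g⁻¹ * x) := rfl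

theorem star_leftRegular (g : G) :
    star (leftRegular g : lp (fun _ : G => ℂ) 2 →L[ℂ] lp (fun _ : G => ℂ) 2) =
      leftRegular g⁻¹ := by
  rw [map_inv, ← Unitary.star_eq_inv, Unitary.coe_star]

theorem leftRegular_mul_mulOperator (g : G) (φ : lp (fun _ : G => ℂ) ∞) :
    leftRegular g * mulOperator φ = mulOperator (translate g φ) * leftRegular g := by
  ext ξ x
  simp

theorem norm_mulOperator_mul_leftRegular (φ : lp (fun _ : G => ℂ) ∞) (g : G) :
    ‖mulOperator φ * (leftRegular g : lp (fun _ : G => ℂ) 2 →L[ℂ] lp (fun _ : G => ℂ) 2)‖ =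
      ‖φ‖ := by
  rw [CStarRing.norm_mul_coe_unitary, norm_mulOperator]

theorem mulOperator_mul_leftRegular_mul (φ ψ : lp (fun _ : G => ℂ) ∞) (g h : G) :
    mulOperator φ * leftRegular g * (mulOperator ψ * leftRegular h) =
      mulOperator (φ * translate g ψ) * leftRegular (g * h) := by
  rw [mul_assoc, ← mul_assoc (leftRegular g : lp (fun _ : G => ℂ) 2 →L[ℂ] lp (fun _ : G => ℂ) 2),
    leftRegular_mul_mulOperator, map_mul, map_mul, Submonoid.coe_mul]
  simp only [mul_assoc]

theorem star_mulOperator_mul_leftRegular (φ : lp (fun _ : G => ℂ) ∞) (g : G) :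
    star (mulOperator φ * leftRegular g) =
      mulOperator (translate g⁻¹ (star φ)) * leftRegular g⁻¹ := by
  rw [star_mul, star_leftRegular, ← map_star, leftRegular_mul_mulOperator]

end HilbertSpace

section Embedding

variable {G : Type u} [Group G]

theorem norm_translate_le (g : G) (φ : lp (fun _ : G => ℂ) ∞) : ‖translate g φ‖ ≤ ‖φ‖ :=
  lp.norm_le_of_forall_le (norm_nonneg φ) fun _ => lp.norm_apply_le_norm ENNReal.top_ne_zero φ _

variable {L : AdmissibleAlgebra G} {𝒜 : InvariantSubalgebra G}

namespace TwoCocycle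

variable (ω : TwoCocycle 𝒜)

/-- A scalar function on `G × G` whose coboundary is the weight of the cocycle, see
`gauge_mul_gauge`: over the coefficient algebra `ℓ^∞(G)` every cocycle is trivial. -/
def gauge (x y : G) : ℂ := ω.weight x y 1

theorem norm_gauge (x y : G) : ‖ω.gauge x y‖ = 1 := ω.norm_weight x y 1

theorem gauge_self (x : G) : ω.gauge x x = 1 := ω.weight_left x 1

theorem gauge_mul_gauge (x z y : G) :
    ω.gauge x z * ω.gauge z y = ω.weight x z y * ω.gauge x y :=
  (mul_comm _ _).trans (ω.weight_cocycle x z y 1).symm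

theorem star_weight_mul_gauge (x y : G) :
    star (ω.weight x y x) * ω.gauge x y = star (ω.gauge y x) := by
  have hweight : ω.gauge x y * ω.gauge y x = ω.weight x y x := by
    rw [gauge_mul_gauge, gauge_self, mul_one]
  have hunit : ω.gauge x y * star (ω.gauge x y) = 1 := ω.weight_mul_conj x y 1
  rw [← hweight, star_mul']
  linear_combination star (ω.gauge y x) * hunit

end TwoCocycle

namespace KernelAlgebra

variable {ω : TwoCocycle 𝒜}

theorem norm_mul_gauge_le {K : KernelAlgebra L 𝒜 ω} {k : G → ℂ}
    (hk : ∀ x y, ‖K.toFun x y‖ ≤ ‖k (x * y⁻¹)‖) (g x : G) :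
    ‖K.toFun x (g⁻¹ * x) * ω.gauge x (g⁻¹ * x)‖ ≤ ‖k g‖ := by
  simpa [ω.norm_gauge] using hk x (g⁻¹ * x)

/-- The `g`-th diagonal `x ↦ K(x, g⁻¹x)` of a kernel, untwisted by the gauge. -/
def diagonal (g : G) : KernelAlgebra L 𝒜 ω →ₗ[ℂ] lp (fun _ : G => ℂ) ∞ where
  toFun K := ⟨fun x => K.toFun x (g⁻¹ * x) * ω.gauge x (g⁻¹ * x), by
    obtain ⟨k, -, hk⟩ := K.exists_dom
    exact memℓp_infty ⟨‖k g‖, Set.forall_mem_range.2 (norm_mul_gauge_le hk g)⟩⟩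
  map_add' K M := by ext x; exact add_mul _ _ _
  map_smul' c K := by ext x; exact mul_assoc _ _ _

theorem diagonal_apply (g : G) (K : KernelAlgebra L 𝒜 ω) (x : G) :
    diagonal g K x = K.toFun x (g⁻¹ * x) * ω.gauge x (g⁻¹ * x) := rfl

theorem norm_diagonal_le {K : KernelAlgebra L 𝒜 ω} {k : G → ℂ}
    (hk : ∀ x y, ‖K.toFun x y‖ ≤ ‖k (x * y⁻¹)‖) (g : G) : ‖diagonal g K‖ ≤ ‖k g‖ :=
  lp.norm_le_of_forall_le (norm_nonneg _) (norm_mul_gauge_le hk g)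

theorem norm_apply_le_norm_diagonal (K : KernelAlgebra L 𝒜 ω) (x y : G) :
    ‖K.toFun x y‖ ≤ ‖diagonal (x * y⁻¹) K‖ := by
  have h := lp.norm_apply_le_norm ENNReal.top_ne_zero (diagonal (x * y⁻¹) K) x
  simpa [diagonal_apply, ω.norm_gauge] using h

theorem summable_norm_diagonal (K : KernelAlgebra L 𝒜 ω) :
    Summable fun g => ‖diagonal g K‖ := by
  obtain ⟨k, hk, hKk⟩ := K.exists_dom
  exact (L.summable k hk).of_nonneg_of_le (fun _ => norm_nonneg _) (norm_diagonal_le hKk)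

theorem summable_diagonal_mul_translate (K M : KernelAlgebra L 𝒜 ω) (g : G) :
    Summable fun h => diagonal h K * translate h (diagonal (h⁻¹ * g) M) := by
  refine .of_norm_bounded (summable_conv (f := fun h => ‖diagonal h K‖)
    (g := fun h => ‖diagonal h M‖) (by simpa using K.summable_norm_diagonal)
    (by simpa using M.summable_norm_diagonal) g) fun h => ?_
  exact (norm_mul_le _ _).trans (mul_le_mul_of_nonneg_left (norm_translate_le _ _) (norm_nonneg _))

theorem hasSum_diagonal_mul_translate (K M : KernelAlgebra L 𝒜 ω) (g : G) :
    HasSum (fun h => diagonal h K * translate h (diagonal (h⁻¹ * g) M)) (diagonal g (K * M)) := by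
  have hsum := K.summable_diagonal_mul_translate M g
  convert! hsum.hasSum
  ext x
  have hcomp : (K * M).toFun x (g⁻¹ * x) = ∑' h, K.toFun x (h⁻¹ * x) *
      M.toFun (h⁻¹ * x) (g⁻¹ * x) * ω.weight x (h⁻¹ * x) (g⁻¹ * x) :=
    (((Equiv.inv G).trans (Equiv.mulRight x)).tsum_eq _).symm
  refine Eq.trans ?_ (hsum.hasSum.mapL (lp.evalCLM ℂ (fun _ : G => ℂ) ∞ x)).tsum_eq
  rw [diagonal_apply, hcomp, ← tsum_mul_right]
  refine tsum_congr fun h => ?_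
  have hindex : (h⁻¹ * g)⁻¹ * (h⁻¹ * x) = g⁻¹ * x := by group
  change _ = diagonal h K x * diagonal (h⁻¹ * g) M (h⁻¹ * x)
  rw [diagonal_apply, diagonal_apply, hindex]
  linear_combination (-K.toFun x (h⁻¹ * x) * M.toFun (h⁻¹ * x) (g⁻¹ * x)) *
    ω.gauge_mul_gauge x (h⁻¹ * x) (g⁻¹ * x)

theorem diagonal_star (K : KernelAlgebra L 𝒜 ω) (g : G) :
    diagonal g (star K) = translate g (star (diagonal g⁻¹ K)) := by
  ext x
  simp [diagonal_apply, adj_eq, ← ω.star_weight_mul_gauge, mul_left_comm, mul_comm]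

/-- The operator-valued function `g ↦ M_{K_g} λ_g` on `G`, where `K_g` is the `g`-th diagonal of
the kernel `K`, `M` the representation `mulOperator` and `λ` the representation `leftRegular`. -/
def toVector (K : KernelAlgebra L 𝒜 ω) :
    VectorAlgebra L (lp (fun _ : G => ℂ) 2 →L[ℂ] lp (fun _ : G => ℂ) 2) :=
  VectorAlgebra.mk (fun g => mulOperator (diagonal g K) * leftRegular g) (by
    obtain ⟨k, hk, hKk⟩ := K.exists_dom
    refine (L.solid _ k hk fun g => ?_).1
    rw [norm_mulOperator_mul_leftRegular, Complex.norm_real, norm_norm]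
    exact norm_diagonal_le hKk g)

theorem toFun_toVector (K : KernelAlgebra L 𝒜 ω) (g : G) :
    K.toVector.toFun g = mulOperator (diagonal g K) * leftRegular g := rfl

theorem norm_toFun_toVector (K : KernelAlgebra L 𝒜 ω) (g : G) :
    ‖K.toVector.toFun g‖ = ‖diagonal g K‖ :=
  norm_mulOperator_mul_leftRegular _ g

theorem norm_toVector (K : KernelAlgebra L 𝒜 ω) : ‖K.toVector‖ = ‖K‖ := by
  refine le_antisymm (le_of_forall_pos_le_add fun ε hε => ?_) ?_
  · obtain ⟨k, hk, hKk, hlt⟩ := K.exists_dom_lt hε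
    refine (VectorAlgebra.norm_le _ hk fun g => ?_).trans hlt.le
    exact (K.norm_toFun_toVector g).trans_le (norm_diagonal_le hKk g)
  · rw [VectorAlgebra.norm_def]
    refine norm_le K K.toVector.abs_mem fun x y => ?_
    rw [AdmissibleAlgebra.norm_abs, norm_toFun_toVector]
    exact K.norm_apply_le_norm_diagonal x y

theorem toVector_mul (K M : KernelAlgebra L 𝒜 ω) :
    (K * M).toVector = K.toVector * M.toVector := by
  ext1
  funext g
  have hcovariant (h : G) : K.toVector.toFun h * M.toVector.toFun (h⁻¹ * g) =
      mulOperator (diagonal h K * translate h (diagonal (h⁻¹ * g) M)) * leftRegular g := by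
    rw [toFun_toVector, toFun_toVector, mulOperator_mul_leftRegular_mul, mul_inv_cancel_left]
  have hsum := ((K.hasSum_diagonal_mul_translate M g).map mulOperator
    (NonUnitalStarAlgHom.isometry mulOperator mulOperator_injective).continuous).mul_right
    (leftRegular g : lp (fun _ : G => ℂ) 2 →L[ℂ] lp (fun _ : G => ℂ) 2)
  rw [VectorAlgebra.toFun_mul, conv, tsum_congr hcovariant]
  exact hsum.tsum_eq.symm

theorem toVector_star (K : KernelAlgebra L 𝒜 ω) : (star K).toVector = star K.toVector := by
  ext1
  funext g
  rw [VectorAlgebra.toFun_star, invol, toFun_toVector, toFun_toVector,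
    star_mulOperator_mul_leftRegular, inv_inv, diagonal_star]

/-- The isometric embedding of the algebra of twisted kernels in `𝓛(G; B(ℓ²(G)))`. -/
def toVectorHom : KernelAlgebra L 𝒜 ω →⋆ₙₐ[ℂ]
    VectorAlgebra L (lp (fun _ : G => ℂ) 2 →L[ℂ] lp (fun _ : G => ℂ) 2) where
  toFun := toVector
  map_smul' c K := by ext1; funext g; simp [toFun_toVector]
  map_zero' := by ext1; funext g; simp [toFun_toVector]
  map_add' K M := by ext1; funext g; simp [toFun_toVector, add_mul]
  map_mul' := toVector_mul
  map_star' := toVector_star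

theorem isometry_toVectorHom : Isometry (toVectorHom (L := L) (ω := ω)) :=
  AddMonoidHomClass.isometry_of_norm _ norm_toVector

end KernelAlgebra

end Embedding

end TwistedKernel

end

theorem mainTheorem11_general {G : Type u} [Group G] (L : TwistedKernel.AdmissibleAlgebra G)
    (hL : TwistedKernel.IsSymmetric (TwistedKernel.VectorAlgebra L
      (lp (fun _ : G => ℂ) 2 →L[ℂ] lp (fun _ : G => ℂ) 2)))
    (𝒜 : TwistedKernel.InvariantSubalgebra G) (ω : TwistedKernel.TwoCocycle 𝒜) :
    TwistedKernel.IsSymmetric (TwistedKernel.KernelAlgebra L 𝒜 ω) :=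
  .of_isometry TwistedKernel.KernelAlgebra.isometry_toVectorHom hL

theorem mainTheorem11 {G : Type u} [Group G] (L : TwistedKernel.AdmissibleAlgebra G)
    (hG : TwistedKernel.IsRigidlySymmetric L)
    (𝒜 : TwistedKernel.InvariantSubalgebra G) (ω : TwistedKernel.TwoCocycle 𝒜) :
    TwistedKernel.IsSymmetric (TwistedKernel.KernelAlgebra L 𝒜 ω) :=
  mainTheorem11_general L (hG _) 𝒜 ω
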